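/- **Setting.** Let $\Lambda$ be a finite set of agents and $\Omega$ a set of items. Each agent $\lambda$ has a non-negative monotone submodular valuation $f^\lambda$ on the finite subsets of $\Omega$ and a matroid $(\Omega,\mathcal I^\lambda)$ in which every singleton is independent. Distinct items arrive one by one in a finite sequence of unknown length. On arrival, an item is either discarded or assigned to one agent $\lambda$, who adds it to its current set $S^\lambda$ (initially empty) and may irrevocably dispose of items of $S^\lambda$, so that $S^\lambda\in\mathcal I^\lambda$ always holds. The goal is to maximize $\sum_\lambda f^\lambda(S^\lambda)$ at the end. An algorithm is *$r$-competitive* if on every sequence it produces such sets with $\sum_\lambda f^\lambda(S^\lambda)\ge r\sum_\lambda f^\lambda(\mathrm{OPT}^\lambda)$ for every family of pairwise disjoint sets $\mathrm{OPT}^\lambda\in\mathcal I^\lambda$ of items of the sequence. **Notation.** Write $f(u\mid X)=f(X\cup\{u\})-f(X)$. For each agent (superscript $\lambda$ omitted), $A$ is the set of items it has accepted so far (including those disposed of since), $A(u)$ is the value of $A$ just before $u$ arrives, $w(u)=f(u\mid A(u))$, $w_S(u)=f(u\mid A(u)\cap S)$, and $w(X)=\sum_{u\in X}w(u)$, $w_S(X)=\sum_{u\in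 X}w_S(u)$. For $k\ge 4$ let $\alpha_k$ be the unique root in $(3,4)$ of $a=\bigl(1+\frac{a-2}{k+1}\bigr)^{k+1}$. **Rules of the agents.** Each agent uses one of two rules to decide whether it would accept an arriving item $u$ and which item $v$ it would then remove ($v=\bot$ means none, with $w_S(\bot)=0$). * *Rule for general matroids (competitive ratio $1/4$ for a single agent).* If $S+u\in\mathcal I$ and $w(u)>0$, accept $u$ with $v=\bot$. Otherwise let $T=\{t\in S: S-t+u\in\mathcal I\}$; if $T\neq\varnothing$, take $v\in T$ minimizing $w_S$ over $T$ and accept $u$ if and only if $w(u)\ge 2w_S(v)$; if $T=\varnothing$, reject $u$. * *Rule for $k$-uniform matroids, $k\ge4$ (competitive ratio $1/\alpha_k$ for a single agent; $\mathcal I$ consists of the sets with at most $k$ elements).* Accept $u$ if and only if $w(u)>\frac1k\bigl(\alpha_k\,w_S(S)-w(A)\bigr)$; then $v$ is an item of $S$ minimizing $w_S$ if $|S|=k$, and $v=\bot$ if $|S|<k$. **Matching algorithm.** When $u$ arrives, let every agent decide by its rule, based on its current $S^\lambda$ and $A^\lambda$, whether it would accept $u$ and which $v^\lambda$ it would remove.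 If no agent would accept $u$, discard $u$. Otherwise choose, among the agents that would accept $u$, one that maximizes $w^\lambda(u)-w^\lambda_{S^\lambda}(v^\lambda)$ and, for this agent only, set $S^\lambda\leftarrow S^\lambda-v^\lambda+u$ and $A^\lambda\leftarrow A^\lambda+u$. All ties are broken arbitrarily. **Theorem.** Let $\alpha>0$ be such that the above competitive ratio ($1/4$ or $1/\alpha_k$) of the rule used by each agent is at least $1/\alpha$; that is, $\alpha\ge4$ if some agent uses the general rule, and $\alpha\ge\alpha_k$ if some agent uses the $k$-uniform rule. Different agents may use different rules and different $k$. Then the matching algorithm is $\frac1{\alpha+1}$-competitive. -/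

import Mathlib

/-! ### Valuations, agents and their online rules -/

/-- A non-negative monotone submodular valuation on the finite sets of items. -/
structure IsValuation {Ω : Type*} [DecidableEq Ω] (f : Finset Ω → ℝ) : Prop where
  nonneg : ∀ X, 0 ≤ f X
  mono : ∀ X Y, X ⊆ Y → f X ≤ f Y
  submodular : ∀ X Y, f (X ∪ Y) + f (X ∩ Y) ≤ f X + f Y

/-- The matroid on all of `Ω` whose independent sets are the sets with at most `k` elements. -/
def IsUniformMatroid {Ω : Type*} (M : Matroid Ω) (k : ℕ) : Prop :=
  ∀ I : Set Ω, M.Indep I ↔ I.encard ≤ (k : ℕ∞)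

/-- The marginal value `f(u | X) = f(X + u) - f(X)`. -/
def marginal {Ω : Type*} [DecidableEq Ω] (f : Finset Ω → ℝ) (X : Finset Ω) (u : Ω) : ℝ :=
  f (insert u X) - f X

/-- The equation that defines `α_k`, on the interval `(3, 4)`. -/
def IsAlphaRoot (k : ℕ) (a : ℝ) : Prop :=
  3 < a ∧ a < 4 ∧ a = (1 + (a - 2) / ((k : ℝ) + 1)) ^ (k + 1)

/-- Bernoulli's inequality to second order. -/
theorem one_add_pow_ge_quadratic (x : ℝ) (hx : 0 ≤ x) (n : ℕ) :
    1 + n * x + n * ((n : ℝ) - 1) / 2 * x ^ 2 ≤ (1 + x) ^ n := by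
  induction n with
  | zero => simp
  | succ m ih =>
    have hm : 0 ≤ (m : ℝ) * ((m : ℝ) - 1) := by
      rcases Nat.eq_zero_or_pos m with h | h
      · simp [h]
      · have : (1 : ℝ) ≤ m := by exact_mod_cast h
        exact mul_nonneg (by linarith) (by linarith)
    have h1 := mul_le_mul_of_nonneg_right ih (by linarith : (0 : ℝ) ≤ 1 + x)
    have h2 : 0 ≤ (m : ℝ) * ((m : ℝ) - 1) * (x ^ 2 * x) :=
      mul_nonneg hm (by positivity)
    rw [pow_succ (1 + x)]
    push_cast
    refine le_trans ?_ h1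
    nlinarith [h2]

/-- For every `k ≥ 4` the equation that defines `α_k` has exactly one root in `(3, 4)`. -/
theorem existsUnique_isAlphaRoot (k : ℕ) (hk : 4 ≤ k) : ∃! a, IsAlphaRoot k a := by
  have hk' : (4 : ℝ) ≤ k := by exact_mod_cast hk
  have hn : (0 : ℝ) < (k : ℝ) + 1 := by linarith
  have h3 : (1 + ((3 : ℝ) - 2) / ((k : ℝ) + 1)) ^ (k + 1) < 3 := by
    have h : (1 + ((3 : ℝ) - 2) / ((k : ℝ) + 1)) ≤ Real.exp (1 / ((k : ℝ) + 1)) := by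
      have := Real.add_one_le_exp (1 / ((k : ℝ) + 1))
      norm_num at this ⊢
      linarith
    have h' := pow_le_pow_left₀ (by positivity) h (k + 1)
    rw [← Real.exp_nat_mul] at h'
    have he : ((k + 1 : ℕ) : ℝ) * (1 / ((k : ℝ) + 1)) = 1 := by
      push_cast
      field_simp
    rw [he] at h'
    have := Real.exp_one_lt_d9
    linarith
  have h4 : 4 < (1 + ((4 : ℝ) - 2) / ((k : ℝ) + 1)) ^ (k + 1) := by
    have h := one_add_pow_ge_quadratic (((4 : ℝ) - 2) / ((k : ℝ) + 1)) (by positivity) (k + 1)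
    refine lt_of_lt_of_le ?_ h
    have he : (1 : ℝ) + ((k + 1 : ℕ) : ℝ) * (((4 : ℝ) - 2) / ((k : ℝ) + 1))
        + ((k + 1 : ℕ) : ℝ) * (((k + 1 : ℕ) : ℝ) - 1) / 2 * (((4 : ℝ) - 2) / ((k : ℝ) + 1)) ^ 2
        = 3 + 2 * k / ((k : ℝ) + 1) := by
      push_cast
      field_simp
      ring
    rw [he]
    have : 1 < 2 * (k : ℝ) / ((k : ℝ) + 1) := by
      rw [lt_div_iff₀ hn]
      linarith
    linarith
  have hcont : ContinuousOn
      (fun a : ℝ => (1 + (a - 2) / ((k : ℝ) + 1)) ^ (k + 1) - a) (Set.Icc 3 4) := by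
    fun_prop
  obtain ⟨a, ha, hroot⟩ := intermediate_value_Ioo (by norm_num : (3 : ℝ) ≤ 4) hcont
    (show (0 : ℝ) ∈ Set.Ioo _ _ from ⟨by linarith, by linarith⟩)
  have key : ∀ x y : ℝ, IsAlphaRoot k x → IsAlphaRoot k y → ¬ x < y := by
    rintro x y ⟨hx3, -, hx⟩ ⟨-, -, hy⟩ hxy
    have hconv := (convexOn_pow (k + 1) : ConvexOn ℝ (Set.Ici 0) fun x : ℝ => x ^ (k + 1))
    have hyx : 0 < y - 2 := by linarith
    have h := hconv.2 (show (1 : ℝ) ∈ Set.Ici 0 by simp)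
      (show 1 + (y - 2) / ((k : ℝ) + 1) ∈ Set.Ici 0 from by
        simp only [Set.mem_Ici]; positivity)
      (show 0 ≤ (y - x) / (y - 2) from div_nonneg (by linarith) hyx.le)
      (show 0 ≤ (x - 2) / (y - 2) from div_nonneg (by linarith) hyx.le)
      (by field_simp; ring)
    have he : ((y - x) / (y - 2)) • (1 : ℝ)
        + ((x - 2) / (y - 2)) • (1 + (y - 2) / ((k : ℝ) + 1)) = 1 + (x - 2) / ((k : ℝ) + 1) := by
      simp only [smul_eq_mul]
      field_simp
      ring
    simp only [he] at h
    simp only [smul_eq_mul, one_pow, ← hx, ← hy] at h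
    have h' : (y - x) / (y - 2) * 1 + (x - 2) / (y - 2) * y = x - (y - x) / (y - 2) := by
      field_simp
      ring
    rw [h'] at h
    have : 0 < (y - x) / (y - 2) := div_pos (by linarith) hyx
    linarith
  refine ⟨a, ⟨ha.1, ha.2, by linarith⟩, fun b hb => ?_⟩
  have ha' : IsAlphaRoot k a := ⟨ha.1, ha.2, by linarith⟩
  exact le_antisymm (not_lt.mp (key a b ha' hb)) (not_lt.mp (key b a hb ha'))

open Classical in
/-- The number `α_k`: the unique root in `(3, 4)` of `a = (1 + (a - 2) / (k + 1)) ^ (k + 1)`.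
(The value `0` is only taken for those `k < 4` for which there is no such root.) -/
noncomputable def alphaUniform (k : ℕ) : ℝ :=
  if h : ∃! a, IsAlphaRoot k a then h.choose else 0

theorem alphaUniform_spec (k : ℕ) (hk : 4 ≤ k) : IsAlphaRoot k (alphaUniform k) := by
  have h := existsUnique_isAlphaRoot k hk
  rw [alphaUniform, dif_pos h]
  exact h.choose_spec.1

/-- The two online rules with free disposal that an agent may use: the exchange rule for general
matroids, or the threshold rule for `k`-uniform matroids. -/
inductive Rule where
  | general : Rule
  | uniform (k : ℕ) : Rule

/-- A rule fits a matroid: the threshold rule with parameter `k` is meant for `k`-uniform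
matroids with `k ≥ 4`. -/
def Rule.Fits {Ω : Type*} (M : Matroid Ω) : Rule → Prop
  | .general => True
  | .uniform k => 4 ≤ k ∧ IsUniformMatroid M k

/-- The competitive ratio of the two rules for a single agent: `1/4`, respectively `1/α_k`. -/
noncomputable def Rule.ratio : Rule → ℝ
  | .general => 1 / 4
  | .uniform k => 1 / alphaUniform k

/-- What an agent keeps track of: the set `S` it currently holds, the set `A` of all items that it
has ever accepted, and, for each accepted item `v`, the set `prior v = A(v)` of the items that it
had accepted before `v` arrived (`prior` is never consulted outside `A`). -/
structure AgentState (Ω : Type*) where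
  S : Finset Ω
  A : Finset Ω
  prior : Ω → Finset Ω

/-- Nothing has been accepted yet. -/
def AgentState.initial (Ω : Type*) : AgentState Ω := ⟨∅, ∅, fun _ => ∅⟩

section Agent

variable {Ω : Type*} [DecidableEq Ω]

/-- The value `w(u) = f(u | A(u))` of an arriving item `u`. -/
def AgentState.newValue (f : Finset Ω → ℝ) (s : AgentState Ω) (u : Ω) : ℝ :=
  marginal f s.A u

/-- The value `w(v) = f(v | A(v))` of an item `v` accepted earlier. -/
def AgentState.oldValue (f : Finset Ω → ℝ) (s : AgentState Ω) (v : Ω) : ℝ :=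
  marginal f (s.prior v) v

/-- The current value `w_S(v) = f(v | A(v) ∩ S)` of an item `v` accepted earlier. -/
def AgentState.currentValue (f : Finset Ω → ℝ) (s : AgentState Ω) (v : Ω) : ℝ :=
  marginal f (s.prior v ∩ s.S) v

/-- The value `w_S(v)` of the item to be removed, where `none` stands for "no item" and has
value `0`. -/
def AgentState.removedValue (f : Finset Ω → ℝ) (s : AgentState Ω) : Option Ω → ℝ
  | none => 0
  | some v => s.currentValue f v

/-- The items of `S` that can be exchanged for the arriving item `u`. -/
def AgentState.Exchangeable (M : Matroid Ω) (s : AgentState Ω) (u v : Ω) : Prop :=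
  v ∈ s.S ∧ M.Indep (insert u (s.S.erase v) : Finset Ω)

/-- The rule for general matroids, in state `s`, accepts the arriving item `u` and removes the
given item (`none`: removes nothing). No item is accepted in exchange if none is exchangeable. -/
def AcceptsGeneral (f : Finset Ω → ℝ) (M : Matroid Ω) (s : AgentState Ω) (u : Ω) :
    Option Ω → Prop
  | none => M.Indep (insert u s.S : Finset Ω) ∧ 0 < s.newValue f u
  | some v =>
      ¬ (M.Indep (insert u s.S : Finset Ω) ∧ 0 < s.newValue f u) ∧
      s.Exchangeable M u v ∧
      (∀ v', s.Exchangeable M u v' → s.currentValue f v ≤ s.currentValue f v') ∧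
      2 * s.currentValue f v ≤ s.newValue f u

/-- The threshold condition `w(u) > (α_k w_S(S) - w(A)) / k` of the rule for `k`-uniform
matroids. -/
def PassesThreshold (f : Finset Ω → ℝ) (k : ℕ) (s : AgentState Ω) (u : Ω) : Prop :=
  1 / (k : ℝ) * (alphaUniform k * (∑ v ∈ s.S, s.currentValue f v) - ∑ v ∈ s.A, s.oldValue f v)
    < s.newValue f u

/-- The rule for `k`-uniform matroids, in state `s`, accepts the arriving item `u` and removes the
given item (`none`: removes nothing). -/
def AcceptsUniform (f : Finset Ω → ℝ) (k : ℕ) (s : AgentState Ω) (u : Ω) : Option Ω → Prop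
  | none => PassesThreshold f k s u ∧ s.S.card ≠ k
  | some v => PassesThreshold f k s u ∧ s.S.card = k ∧ v ∈ s.S ∧
      ∀ v' ∈ s.S, s.currentValue f v ≤ s.currentValue f v'

/-- An agent with the given rule in state `s` proposes to accept `u` and to remove the given item.
There are several such items only if there are ties for the minimum of `w_S`. -/
def Rule.Proposes (r : Rule) (f : Finset Ω → ℝ) (M : Matroid Ω) (s : AgentState Ω) (u : Ω)
    (v : Option Ω) : Prop :=
  match r with
  | .general => AcceptsGeneral f M s u v
  | .uniform k => AcceptsUniform f k s u v

/-- The update `S ← S - v + u`, `A ← A + u` (with `A(u)` recorded). -/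
def AgentState.accept (s : AgentState Ω) (u : Ω) (v : Option Ω) : AgentState Ω where
  S := insert u (v.elim s.S fun x => s.S.erase x)
  A := insert u s.A
  prior := Function.update s.prior u s.A

end Agent

/-! ### The matching algorithm and its competitive ratio -/

section Matching

variable {Ω Λ : Type*} [DecidableEq Ω] [DecidableEq Λ]

/-- One round of the matching algorithm, in which `u` arrives. If no agent proposes, then `u` is
discarded. Otherwise `u` goes to an agent `l` whose proposal (to remove `v`) has the largest gain
`w(u) - w_S(v)`; ties are broken arbitrarily, both here and inside the rules of the agents. -/
inductive MatchingStep (f : Λ → Finset Ω → ℝ) (M : Λ → Matroid Ω) (rule : Λ → Rule)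
    (σ : Λ → AgentState Ω) (u : Ω) : (Λ → AgentState Ω) → Prop where
  | discard (h : ∀ l v, ¬ (rule l).Proposes (f l) (M l) (σ l) u v) :
      MatchingStep f M rule σ u σ
  | assign (l : Λ) (v : Option Ω) (h : (rule l).Proposes (f l) (M l) (σ l) u v)
      (hmax : ∀ l' v', (rule l').Proposes (f l') (M l') (σ l') u v' →
        (σ l').newValue (f l') u - (σ l').removedValue (f l') v' ≤
          (σ l).newValue (f l) u - (σ l).removedValue (f l) v) :
      MatchingStep f M rule σ u (Function.update σ l ((σ l).accept u v))

/-- The matching algorithm, started in state `σ`, may be in state `τ` after the items of the list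
have arrived, in the order of the list. -/
inductive MatchingRun (f : Λ → Finset Ω → ℝ) (M : Λ → Matroid Ω) (rule : Λ → Rule) :
    (Λ → AgentState Ω) → List Ω → (Λ → AgentState Ω) → Prop where
  | nil (σ : Λ → AgentState Ω) : MatchingRun f M rule σ [] σ
  | cons {σ σ' τ : Λ → AgentState Ω} {u : Ω} {us : List Ω}
      (hstep : MatchingStep f M rule σ u σ') (hrun : MatchingRun f M rule σ' us τ) :
      MatchingRun f M rule σ (u :: us) τ

/-- On the arrival sequence `items`, the matching algorithm may end with agent `l` holding `X l`,
for all `l`. -/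
def MatchingOutcome (f : Λ → Finset Ω → ℝ) (M : Λ → Matroid Ω) (rule : Λ → Rule)
    (items : List Ω) (X : Λ → Finset Ω) : Prop :=
  ∃ τ : Λ → AgentState Ω,
    MatchingRun f M rule (fun _ => AgentState.initial Ω) items τ ∧ ∀ l, X l = (τ l).S

end Matching

/-- A feasible assignment: the agents get pairwise disjoint sets of arrived items, and the set of
each agent is independent in its matroid. -/
structure IsAssignment {Ω Λ : Type*} [DecidableEq Ω] (M : Λ → Matroid Ω) (items : List Ω)
    (X : Λ → Finset Ω) : Prop where
  arrived : ∀ l, X l ⊆ items.toFinset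
  disjoint : ∀ l l', l ≠ l' → Disjoint (X l) (X l')
  indep : ∀ l, (M l).Indep (X l : Set Ω)

/-- An algorithm, given by its possible outcomes on each arrival sequence, is `r`-competitive: on
every finite sequence of distinct items it has an outcome, and each of its possible outcomes is a
feasible assignment whose total value is at least `r` times that of every (hence of an optimal)
offline assignment of the items of the sequence. -/
def IsCompetitive {Ω Λ : Type*} [DecidableEq Ω] [Fintype Λ] (f : Λ → Finset Ω → ℝ)
    (M : Λ → Matroid Ω) (outcome : List Ω → (Λ → Finset Ω) → Prop) (r : ℝ) : Prop :=
  ∀ items : List Ω, items.Nodup →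
    (∃ X, outcome items X) ∧
    ∀ X, outcome items X →
      IsAssignment M items X ∧
      ∀ OPT : Λ → Finset Ω, IsAssignment M items OPT →
        r * ∑ l, f l (OPT l) ≤ ∑ l, f l (X l)

/-! ### Marginal values and coherent agent states -/

section Basics

variable {Ω : Type*} [DecidableEq Ω] {f : Finset Ω → ℝ} {M : Matroid Ω}

/-! Each assigned item `u` receives as credit `p u` the gain `w(u) - w_S(v)` of its assignment;
discarded items receive credit 0. By submodularity the gain is at most the increase of the value
held by the winner (`gain_le`), and gains are non-negative, so all credits together are at most `∑
f(S)`. The greedy choice makes `p u` at least the gain that any losing agent proposed for `u`. From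
the viewpoint of one agent, an item lost to another agent therefore behaves like a rejected item
once its marginal is reduced by `p u`. The single-agent analysis then gives `f(I) ≤ α f(S) + ∑_{u ∈
I} p u` for every independent `I` (`Rule.Certified.value_le`). Summing over the disjoint sets of an
offline assignment counts each credit at most once, which yields the factor `α + 1`.

Both rules are analysed through `f(I) ≤ f(A) + ∑_{u ∈ I \ A} f(u | A)`. For the general rule, every
exchange gains at least half of `w(u)`, so `f(A)` is at most about `2 f(S)`. The lost items are
spanned by held items of at least half their reduced marginal (`SpansRejected`), and comparing ranks
level by level costs another `2 f(S)`. For the uniform rule, the potential `Φ = α_k w_S(S) - w(A)`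
never decreases, and each lost item has reduced marginal at most `Φ / k`. At most `k` such items
cost `Φ`, in which `w(A)` cancels. Monotonicity of `Φ` needs the least held item to be small
compared with `Φ`; this follows from the invariant `RankBound`, whose geometric weights have ratio
`r` with `r ^ (k + 1) = α_k`. -/

theorem IsValuation.marginal_nonneg (hf : IsValuation f) (X : Finset Ω) (u : Ω) :
    0 ≤ marginal f X u :=
  sub_nonneg.2 (hf.mono _ _ (Finset.subset_insert u X))

theorem IsValuation.marginal_anti (hf : IsValuation f) {X Y : Finset Ω} (h : X ⊆ Y) (u : Ω) :
    marginal f Y u ≤ marginal f X u := by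
  by_cases hu : u ∈ Y
  · have : marginal f Y u = 0 := by simp [marginal, hu]
    rw [this]
    exact hf.marginal_nonneg X u
  · have h1 := hf.submodular (insert u X) Y
    have h2 : insert u X ∪ Y = insert u Y := by
      rw [Finset.insert_union, Finset.union_eq_right.2 h]
    have h3 : insert u X ∩ Y = X := by
      rw [Finset.insert_inter_of_notMem hu, Finset.inter_eq_left.2 h]
    rw [h2, h3] at h1
    unfold marginal
    linarith

/-- The value of a union is at most the value of one part plus the marginals of the other. -/
theorem IsValuation.le_add_sum_marginal (hf : IsValuation f) (A R : Finset Ω) :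
    f (A ∪ R) ≤ f A + ∑ u ∈ R, marginal f A u := by
  induction R using Finset.induction_on with
  | empty => simp
  | insert u R hu ih =>
    rw [Finset.sum_insert hu, Finset.union_insert]
    have h := hf.marginal_anti (Finset.subset_union_left : A ⊆ A ∪ R) u
    unfold marginal at h ih ⊢
    linarith

theorem IsValuation.currentValue_nonneg (hf : IsValuation f) (s : AgentState Ω) (v : Ω) :
    0 ≤ s.currentValue f v :=
  hf.marginal_nonneg _ _

theorem IsValuation.removedValue_nonneg (hf : IsValuation f) (s : AgentState Ω) (v : Option Ω) :
    0 ≤ s.removedValue f v := by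
  cases v
  · exact le_rfl
  · exact hf.currentValue_nonneg _ _

/-- The structural facts that hold of an agent in matroid `M` at every time, where `R` is the set
of the items that have arrived. -/
structure AgentState.Coherent (f : Finset Ω → ℝ) (M : Matroid Ω) (s : AgentState Ω)
    (R : Finset Ω) : Prop where
  held_subset : s.S ⊆ s.A
  accepted_subset : s.A ⊆ R
  prior_subset : ∀ v ∈ s.A, s.prior v ⊆ s.A
  telescope : ∀ X ⊆ s.A, ∑ v ∈ X, marginal f (s.prior v ∩ X) v = f X - f ∅
  indep : M.Indep (s.S : Set Ω)

namespace AgentState.Coherent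

variable {s : AgentState Ω} {R : Finset Ω}

theorem mono (h : s.Coherent f M R) {R' : Finset Ω} (hR : R ⊆ R') : s.Coherent f M R' :=
  { h with accepted_subset := h.accepted_subset.trans hR }

theorem sum_currentValue (h : s.Coherent f M R) :
    ∑ v ∈ s.S, s.currentValue f v = f s.S - f ∅ :=
  h.telescope s.S h.held_subset

theorem sum_oldValue (h : s.Coherent f M R) : ∑ v ∈ s.A, s.oldValue f v = f s.A - f ∅ := by
  rw [← h.telescope s.A subset_rfl]
  refine Finset.sum_congr rfl fun v hv => ?_
  rw [Finset.inter_eq_left.2 (h.prior_subset v hv)]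
  rfl

/-- The arriving item is last in the order encoded by `prior`, so it appends one final term to each
telescoping sum and leaves the others alone. -/
theorem accept (h : s.Coherent f M R) {u : Ω} (hu : u ∉ R) {v : Option Ω}
    (hind : M.Indep ((s.accept u v).S : Set Ω)) :
    (s.accept u v).Coherent f M (insert u R) where
  held_subset := by
    refine Finset.insert_subset_insert u ?_
    cases v
    · exact h.held_subset
    · exact (Finset.erase_subset _ _).trans h.held_subset
  accepted_subset := Finset.insert_subset_insert u h.accepted_subset
  prior_subset := by
    intro t ht
    have huA : u ∉ s.A := fun h' => hu (h.accepted_subset h')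
    refine Finset.Subset.trans ?_ (Finset.subset_insert u s.A)
    by_cases htu : t = u
    · simp [AgentState.accept, htu]
    · have htA : t ∈ s.A := (Finset.mem_insert.1 ht).resolve_left htu
      simpa [AgentState.accept, htu] using h.prior_subset t htA
  telescope := by
    intro X hX
    have huA : u ∉ s.A := fun h' => hu (h.accepted_subset h')
    -- Since `prior t ⊆ A`, intersecting it with `Z` or with `Z ∩ A` gives the same set, so a
    -- possible `u ∈ Z` is invisible to older items.
    have hprior : ∀ Y ⊆ s.A, ∀ Z, Z ∩ s.A = Y →
        ∑ t ∈ Y, marginal f ((s.accept u v).prior t ∩ Z) t = f Y - f ∅ := by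
      intro Y hY Z hZ
      rw [← h.telescope Y hY]
      refine Finset.sum_congr rfl fun t ht => ?_
      have htu : t ≠ u := fun e => huA (e ▸ hY ht)
      have : (s.accept u v).prior t = s.prior t := by simp [AgentState.accept, htu]
      rw [this, ← hZ, Finset.inter_comm Z, ← Finset.inter_assoc,
        Finset.inter_eq_left.2 (h.prior_subset t (hY ht))]
    by_cases huX : u ∈ X
    · have hY : X.erase u ⊆ s.A := by
        intro t ht
        exact (Finset.mem_insert.1 (hX (Finset.mem_of_mem_erase ht))).resolve_left
          (Finset.ne_of_mem_erase ht)
      have hXA : X ∩ s.A = X.erase u := by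
        ext t
        simp only [Finset.mem_inter, Finset.mem_erase]
        constructor
        · exact fun ⟨h1, h2⟩ => ⟨fun e => huA (e ▸ h2), h1⟩
        · exact fun h1 => ⟨h1.2, hY (Finset.mem_erase.2 h1)⟩
      rw [← Finset.add_sum_erase _ _ huX, hprior _ hY X hXA]
      -- The term of `u` is `f X - f (X - u)`, because `A ∩ X = X - u`.
      have : (s.accept u v).prior u = s.A := by simp [AgentState.accept]
      rw [this, Finset.inter_comm, hXA, marginal, Finset.insert_erase huX]
      ring
    · have hY : X ⊆ s.A := fun t ht =>
        (Finset.mem_insert.1 (hX ht)).resolve_left fun e => huX (e ▸ ht)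
      exact hprior X hY X (Finset.inter_eq_left.2 hY)
  indep := hind

/-- The newcomer `u` is in no older `A(t)`, so `A(t) ∩ S` can only lose the removed item; by
submodularity marginals over it can only rise. -/
theorem currentValue_le_accept (hf : IsValuation f) (h : s.Coherent f M R) {u : Ω} (hu : u ∉ R)
    (v : Option Ω) {t : Ω} (ht : t ∈ s.A) :
    s.currentValue f t ≤ (s.accept u v).currentValue f t := by
  have huA : u ∉ s.A := fun h' => hu (h.accepted_subset h')
  have htu : t ≠ u := fun e => huA (e ▸ ht)
  have hp : (s.accept u v).prior t = s.prior t := by simp [AgentState.accept, htu]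
  unfold AgentState.currentValue
  rw [hp]
  refine hf.marginal_anti (fun x hx => ?_) t
  obtain ⟨hx1, hx2⟩ := Finset.mem_inter.1 hx
  refine Finset.mem_inter.2 ⟨hx1, ?_⟩
  have hxu : x ≠ u := fun e => huA (e ▸ h.prior_subset t ht hx1)
  have := (Finset.mem_insert.1 hx2).resolve_left hxu
  cases v
  · exact this
  · exact Finset.mem_of_mem_erase this

theorem newValue_le_accept (hf : IsValuation f) (s : AgentState Ω) (u : Ω) (v : Option Ω) :
    s.newValue f u ≤ (s.accept u v).currentValue f u := by
  have hp : (s.accept u v).prior u = s.A := by simp [AgentState.accept]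
  unfold AgentState.currentValue
  rw [hp]
  exact hf.marginal_anti Finset.inter_subset_left u

/-- Weighted sums of current values after an exchange, in terms of the values before it. -/
theorem weighted_sum_accept (hf : IsValuation f) (h : s.Coherent f M R) {u : Ω} (hu : u ∉ R)
    (v : Option Ω) (c : Ω → ℝ) (hc : ∀ t ∈ (s.accept u v).S, 0 ≤ c t) :
    c u * s.newValue f u + ∑ t ∈ v.elim s.S (fun x => s.S.erase x), c t * s.currentValue f t ≤
      ∑ t ∈ (s.accept u v).S, c t * (s.accept u v).currentValue f t := by
  have huA : u ∉ s.A := fun h' => hu (h.accepted_subset h')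
  have hsub : v.elim s.S (fun x => s.S.erase x) ⊆ s.S := by
    cases v
    · exact subset_rfl
    · exact Finset.erase_subset _ _
  have hnot : u ∉ v.elim s.S (fun x => s.S.erase x) := fun h' => huA (h.held_subset (hsub h'))
  have hS : (s.accept u v).S = insert u (v.elim s.S (fun x => s.S.erase x)) := rfl
  rw [hS] at hc ⊢
  rw [Finset.sum_insert hnot]
  refine add_le_add (mul_le_mul_of_nonneg_left (newValue_le_accept hf s u v)
    (hc u (Finset.mem_insert_self _ _))) (Finset.sum_le_sum fun t ht => ?_)
  exact mul_le_mul_of_nonneg_left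
    (currentValue_le_accept hf h hu v (h.held_subset (hsub ht)))
    (hc t (Finset.mem_insert_of_mem ht))

/-- The gain of an exchange is a lower bound for the increase of the value of the held set. -/
theorem gain_le (hf : IsValuation f) (h : s.Coherent f M R) {u : Ω} (hu : u ∉ R)
    {v : Option Ω} (hv : ∀ x ∈ v, x ∈ s.S) (hind : M.Indep ((s.accept u v).S : Set Ω)) :
    s.newValue f u - s.removedValue f v ≤ f (s.accept u v).S - f s.S := by
  have h1 := weighted_sum_accept hf h hu v (fun _ => 1) (fun _ _ => zero_le_one)
  simp only [one_mul] at h1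
  rw [(h.accept hu hind).sum_currentValue] at h1
  have h2 := h.sum_currentValue
  cases v with
  | none =>
    simp only [Option.elim, AgentState.removedValue] at h1 ⊢
    linarith
  | some x =>
    rw [← Finset.add_sum_erase _ _ (hv x rfl)] at h2
    simp only [Option.elim, AgentState.removedValue] at h1 ⊢
    linarith

theorem value_accepted_accept (s : AgentState Ω) (u : Ω) (v : Option Ω) :
    f (s.accept u v).A = f s.A + s.newValue f u := by
  simp [AgentState.accept, AgentState.newValue, marginal]

end AgentState.Coherent

theorem Rule.Proposes.mem_held {r : Rule} {s : AgentState Ω} {u : Ω} {v : Option Ω}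
    (h : r.Proposes f M s u v) : ∀ x ∈ v, x ∈ s.S := by
  rintro x rfl
  cases r
  · exact h.2.1.1
  · exact h.2.2.1

theorem Rule.Proposes.indep {r : Rule} (hr : r.Fits M) {s : AgentState Ω}
    (hs : M.Indep (s.S : Set Ω)) {u : Ω} {v : Option Ω}
    (h : r.Proposes f M s u v) : M.Indep ((s.accept u v).S : Set Ω) := by
  cases r with
  | general =>
    cases v
    · exact h.1
    · exact h.2.1.2
  | uniform k =>
    have hle := (hr.2 _).1 hs
    rw [Set.encard_coe_eq_coe_finsetCard, Nat.cast_le] at hle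
    refine (hr.2 _).2 ?_
    rw [Set.encard_coe_eq_coe_finsetCard, Nat.cast_le]
    refine (Finset.card_insert_le _ _).trans ?_
    cases v with
    | none => exact lt_of_le_of_ne hle h.2
    | some x =>
      have := Finset.card_erase_of_mem h.2.2.1
      -- Positivity of `k` makes the truncated difference `k - 1` exact.
      have h4 := hr.1
      have hk : s.S.card = k := h.2.1
      simp only [Option.elim]
      omega

end Basics

/-! ### The rule for uniform matroids -/

section Uniform

/-- The growth rate of the items accepted by the threshold rule in its extremal run. -/
noncomputable def uniformGrowth (k : ℕ) : ℝ := 1 + (alphaUniform k - 2) / ((k : ℝ) + 1)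

theorem uniformGrowth_pow {k : ℕ} (hk : 4 ≤ k) : uniformGrowth k ^ (k + 1) = alphaUniform k :=
  (alphaUniform_spec k hk).2.2.symm

theorem uniformGrowth_sub_one {k : ℕ} : (k + 1) * (uniformGrowth k - 1) = alphaUniform k - 2 := by
  unfold uniformGrowth
  field_simp
  ring

theorem one_lt_uniformGrowth {k : ℕ} (hk : 4 ≤ k) : 1 < uniformGrowth k := by
  have h := (alphaUniform_spec k hk).1
  have : 0 < (alphaUniform k - 2) / ((k : ℝ) + 1) := div_pos (by linarith) (by positivity)
  unfold uniformGrowth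
  linarith

/-- Removing the position `j` of a geometric progression and moving up the earlier positions. -/
theorem sum_range_removal (r : ℝ) (j m : ℕ) :
    ∑ i ∈ Finset.range m,
        (r ^ (i + 2) - if i = j then 0 else r ^ ((if i < j then i + 1 else i) + 1)) =
      if m ≤ j then 0 else r ^ (m + 1) := by
  induction m with
  | zero => simp
  | succ m ih =>
    rw [Finset.sum_range_succ, ih]
    rcases lt_trichotomy m j with h | h | h
    · have : m + 1 ≤ j := h
      simp [h, h.ne, h.le, this]
    · simp [h]
    · have h1 : ¬ m ≤ j := by omega
      have h2 : ¬ m + 1 ≤ j := by omega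
      have h3 : ¬ m < j := by omega
      simp only [h1, h2, h3, h.ne', if_false]
      ring

/-! ### Ranked sets and geometric weights. -/

variable {Ω : Type*}

/-- If `n` ranks `S` by `0, …, |S| - 1`, then sums over `S` of functions of the rank are sums over
a range. -/
theorem sum_rank_eq_sum_range {S : Finset Ω} {n : Ω → ℕ}
    (hn : S.image n = Finset.range S.card) (g : ℕ → ℝ) :
    ∑ t ∈ S, g (n t) = ∑ i ∈ Finset.range S.card, g i := by
  rw [← hn, Finset.sum_image]
  exact Finset.card_image_iff.1 (by rw [hn, Finset.card_range])

theorem rank_lt_card {S : Finset Ω} {n : Ω → ℕ}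
    (hn : S.image n = Finset.range S.card) {t : Ω} (ht : t ∈ S) : n t < S.card :=
  Finset.mem_range.1 (hn ▸ Finset.mem_image_of_mem n ht)

/-- The rank-weighted sum bounds the minimal value. -/
theorem minimal_mul_le_rank_sum {S : Finset Ω} {n : Ω → ℕ}
    (hn : S.image n = Finset.range S.card) {v : Ω} {x : Ω → ℝ}
    (hmin : ∀ t ∈ S, x v ≤ x t) {r : ℝ} (hr : 1 ≤ r) :
    (r ^ (S.card + 1) - r) * x v ≤ (r - 1) * ∑ t ∈ S, r ^ (n t + 1) * x t := by
  have hgeom : ∀ m : ℕ, r ^ (m + 1) - r = (r - 1) * ∑ i ∈ Finset.range m, r ^ (i + 1) := by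
    intro m
    induction m with
    | zero => simp
    | succ m ih => rw [Finset.sum_range_succ, mul_add, ← ih]; ring
  rw [hgeom, mul_assoc, ← sum_rank_eq_sum_range hn (fun i => r ^ (i + 1)), Finset.sum_mul]
  refine mul_le_mul_of_nonneg_left (Finset.sum_le_sum fun t ht => ?_) (by linarith)
  exact mul_le_mul_of_nonneg_left (hmin t ht) (by positivity)

variable [DecidableEq Ω]

/-- The ranks after the removal of an item of rank `j` and the insertion of `u` at rank `0`. -/
def shiftedRank (n : Ω → ℕ) (j : ℕ) (u : Ω) : Ω → ℕ :=
  Function.update (fun t => if n t < j then n t + 1 else n t) u 0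

theorem image_shiftedRank_insert {S : Finset Ω} {n : Ω → ℕ}
    (hn : S.image n = Finset.range S.card) {u : Ω} (hu : u ∉ S) :
    (insert u S).image (shiftedRank n S.card u) = Finset.range (insert u S).card := by
  have hS : ∀ t ∈ S, shiftedRank n S.card u t = n t + 1 := by
    intro t ht
    have htu : t ≠ u := fun e => hu (e ▸ ht)
    simp [shiftedRank, htu, rank_lt_card hn ht]
  rw [Finset.card_insert_of_notMem hu, Finset.image_insert, Finset.image_congr
    (g := fun t => n t + 1) (fun t ht => hS t ht)]
  have : S.image (fun t => n t + 1) = (Finset.range S.card).image (· + 1) := by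
    rw [← hn, Finset.image_image]; rfl
  rw [this]
  ext i
  simp only [shiftedRank, Function.update_self, Finset.mem_insert, Finset.mem_image,
    Finset.mem_range]
  constructor
  · rintro (rfl | ⟨a, ha, rfl⟩) <;> omega
  · intro hi
    rcases i with _ | i
    · exact Or.inl rfl
    · exact Or.inr ⟨i, by omega, rfl⟩

theorem image_shiftedRank_exchange {S : Finset Ω} {n : Ω → ℕ}
    (hn : S.image n = Finset.range S.card) {u v : Ω} (hu : u ∉ S) (hv : v ∈ S) :
    (insert u (S.erase v)).image (shiftedRank n (n v) u) =
      Finset.range (insert u (S.erase v)).card := by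
  have hinj : Set.InjOn n S := Finset.card_image_iff.1 (by rw [hn, Finset.card_range])
  have hue : u ∉ S.erase v := fun h => hu (Finset.mem_of_mem_erase h)
  have hval : ∀ t ∈ S.erase v, shiftedRank n (n v) u t = if n t < n v then n t + 1 else n t := by
    intro t ht
    have htu : t ≠ u := fun e => hue (e ▸ ht)
    simp [shiftedRank, htu]
  have hcard : (insert u (S.erase v)).card = S.card := by
    rw [Finset.card_insert_of_notMem hue, Finset.card_erase_add_one hv]
  have h0 : shiftedRank n (n v) u u = 0 := by simp [shiftedRank]
  have hne : ∀ t ∈ S.erase v, n t ≠ n v := fun t ht e =>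
    Finset.ne_of_mem_erase ht (hinj (Finset.mem_of_mem_erase ht) hv e)
  rw [hcard]
  -- The new ranks lie in the range and are distinct: only `u` has rank 0, and the ranks below `n v`
  -- move up to fill the gap at `n v`.
  refine Finset.eq_of_subset_of_card_le (fun i hi => ?_) ?_
  · obtain ⟨t, ht, rfl⟩ := Finset.mem_image.1 hi
    have hvlt := rank_lt_card hn hv
    rw [Finset.mem_range]
    rcases Finset.mem_insert.1 ht with rfl | ht
    · omega
    · have := rank_lt_card hn (Finset.mem_of_mem_erase ht)
      rw [hval t ht]
      split_ifs <;> omega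
  · rw [Finset.card_range, ← hcard]
    refine (Finset.card_image_iff.2 fun a ha b hb hab => ?_).ge
    have key : ∀ t ∈ S.erase v, shiftedRank n (n v) u t ≠ 0 := by
      intro t ht
      have := hne t ht
      rw [hval t ht]
      split_ifs <;> omega
    rw [Finset.mem_coe] at ha hb
    rcases Finset.mem_insert.1 ha with ha | ha <;> rcases Finset.mem_insert.1 hb with hb | hb
    · rw [ha, hb]
    · rw [ha, h0] at hab
      exact absurd hab.symm (key b hb)
    · rw [hb, h0] at hab
      exact absurd hab (key a ha)
    · have h1 := hne a ha
      have h2 := hne b hb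
      rw [hval a ha, hval b hb] at hab
      refine hinj (Finset.mem_of_mem_erase ha) (Finset.mem_of_mem_erase hb) ?_
      split_ifs at hab <;> omega

/-- The change of the rank-weighted sum under an exchange that removes an item of minimal value. -/
theorem rank_sum_exchange_le {S : Finset Ω} {n : Ω → ℕ}
    (hn : S.image n = Finset.range S.card) {u v : Ω} (hu : u ∉ S) (hv : v ∈ S) {x : Ω → ℝ}
    (hmin : ∀ t ∈ S, x v ≤ x t) {r : ℝ} (hr : 1 ≤ r) :
    ∑ t ∈ S.erase v, r ^ (shiftedRank n (n v) u t + 1) * x t + r ^ (S.card + 1) * x v ≤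
      r * ∑ t ∈ S, r ^ (n t + 1) * x t := by
  have hinj : Set.InjOn n S := Finset.card_image_iff.1 (by rw [hn, Finset.card_range])
  -- `e i` is the weight at rank `i` multiplied by `r`, minus the weight after the exchange (0 for
  -- the removed item). These differences are non-negative and telescope to `r ^ (|S| + 1)`, so
  -- replacing every value by the minimal one gives the bound.
  set e : ℕ → ℝ := fun i =>
    r ^ (i + 2) - if i = n v then 0 else r ^ ((if i < n v then i + 1 else i) + 1) with he
  have he0 : ∀ i, 0 ≤ e i := by
    intro i
    have hp : ∀ a b : ℕ, a ≤ b → r ^ a ≤ r ^ b := fun a b h => pow_le_pow_right₀ hr h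
    simp only [he]
    split_ifs with h1 h2
    · have : 0 ≤ r ^ (i + 2) := by positivity
      linarith
    · linarith [hp (i + 1 + 1) (i + 2) le_rfl]
    · linarith [hp (i + 1) (i + 2) (by omega)]
  have hsum : ∑ t ∈ S, e (n t) = r ^ (S.card + 1) := by
    rw [sum_rank_eq_sum_range hn e, sum_range_removal, if_neg (rank_lt_card hn hv).not_ge]
  have h1 : r ^ (S.card + 1) * x v ≤ ∑ t ∈ S, e (n t) * x t := by
    rw [← hsum, Finset.sum_mul]
    exact Finset.sum_le_sum fun t ht => mul_le_mul_of_nonneg_left (hmin t ht) (he0 _)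
  have h2 : ∑ t ∈ S, e (n t) * x t = r * ∑ t ∈ S, r ^ (n t + 1) * x t -
      ∑ t ∈ S.erase v, r ^ (shiftedRank n (n v) u t + 1) * x t := by
    rw [Finset.mul_sum, ← Finset.add_sum_erase _ (fun t => e (n t) * x t) hv,
      ← Finset.add_sum_erase _ (fun t => r * (r ^ (n t + 1) * x t)) hv, add_sub_assoc,
      ← Finset.sum_sub_distrib]
    congr 1
    · simp only [he, if_true]
      ring
    · refine Finset.sum_congr rfl fun t ht => ?_
      have htu : t ≠ u := fun h => hu (h ▸ Finset.mem_of_mem_erase ht)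
      have htv : n t ≠ n v := fun h =>
        Finset.ne_of_mem_erase ht (hinj (Finset.mem_of_mem_erase ht) hv h)
      have : shiftedRank n (n v) u t = if n t < n v then n t + 1 else n t := by
        simp [shiftedRank, htu]
      rw [this]
      simp only [he, htv, if_false]
      ring
  linarith

/-! ### The potential of the threshold rule and its invariant. -/

variable {f : Finset Ω → ℝ} {M : Matroid Ω} {s : AgentState Ω} {R : Finset Ω} {k : ℕ}

/-- The potential `α_k w_S(S) - w(A)` of the threshold rule. -/
noncomputable def uniformPotential (f : Finset Ω → ℝ) (k : ℕ) (s : AgentState Ω) : ℝ :=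
  alphaUniform k * (f s.S - f ∅) - (f s.A - f ∅)

/-- The invariant of the threshold rule: the potential bounds a sum of the current values with
geometric weights. -/
def RankBound (f : Finset Ω → ℝ) (k : ℕ) (s : AgentState Ω) : Prop :=
  ∃ n : Ω → ℕ, s.S.image n = Finset.range s.S.card ∧
    ∑ t ∈ s.S, uniformGrowth k ^ (n t + 1) * s.currentValue f t ≤ uniformPotential f k s

theorem AgentState.Coherent.passesThreshold_iff (h : s.Coherent f M R) (hk : 4 ≤ k) {u : Ω} :
    PassesThreshold f k s u ↔ uniformPotential f k s < k * s.newValue f u := by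
  have hk0 : (0 : ℝ) < k := by exact_mod_cast (by omega : 0 < k)
  rw [PassesThreshold, h.sum_currentValue, h.sum_oldValue, one_div, inv_mul_lt_iff₀ hk0]
  rfl

theorem RankBound.potential_nonneg (hf : IsValuation f) (hk : 4 ≤ k) (h : RankBound f k s) :
    0 ≤ uniformPotential f k s := by
  obtain ⟨n, -, h⟩ := h
  refine le_trans (Finset.sum_nonneg fun t _ => ?_) h
  have := one_lt_uniformGrowth hk
  exact mul_nonneg (by positivity) (hf.currentValue_nonneg s t)

/-- The potential of a full agent controls its least valuable item. -/
theorem RankBound.minimal_le (hk : 4 ≤ k) (h : RankBound f k s) (hcard : s.S.card = k) {v : Ω}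
    (hmin : ∀ t ∈ s.S, s.currentValue f v ≤ s.currentValue f t) :
    (1 + k * (uniformGrowth k - 1)) * s.currentValue f v ≤
      (uniformGrowth k - 1) * uniformPotential f k s := by
  obtain ⟨n, hn, h⟩ := h
  have hr := one_lt_uniformGrowth hk
  have h1 := minimal_mul_le_rank_sum hn hmin hr.le
  have h2 := uniformGrowth_sub_one (k := k)
  rw [hcard, uniformGrowth_pow hk] at h1
  have h3 := mul_le_mul_of_nonneg_left h (by linarith : 0 ≤ uniformGrowth k - 1)
  -- This is `(k + 1)(r - 1) = α_k - 2` rearranged.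
  have h4 : alphaUniform k - uniformGrowth k = 1 + k * (uniformGrowth k - 1) := by linarith
  rw [h4] at h1
  linarith

theorem RankBound.removedValue_le (hf : IsValuation f) (hk : 4 ≤ k) (h : RankBound f k s)
    {u : Ω} {v : Option Ω} (hv : AcceptsUniform f k s u v) :
    k * s.removedValue f v ≤ uniformPotential f k s := by
  cases v with
  | none =>
    simp only [AgentState.removedValue, mul_zero]
    exact h.potential_nonneg hf hk
  | some v =>
    have h1 := h.minimal_le hk hv.2.1 hv.2.2.2
    have hr := one_lt_uniformGrowth hk
    have h0 := hf.currentValue_nonneg s v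
    simp only [AgentState.removedValue]
    by_contra! hlt
    have := mul_lt_mul_of_pos_left hlt (by linarith : 0 < uniformGrowth k - 1)
    nlinarith

/-- The potential separates the two values: `k w_S(v) ≤ Φ < k w(u)`. -/
theorem RankBound.gain_nonneg (hf : IsValuation f) (hs : s.Coherent f M R) (hk : 4 ≤ k)
    (h : RankBound f k s) {u : Ω} {v : Option Ω} (hv : AcceptsUniform f k s u v) :
    0 ≤ s.newValue f u - s.removedValue f v := by
  have h1 := h.removedValue_le hf hk hv
  have h2 : PassesThreshold f k s u := by
    cases v
    · exact hv.1
    · exact hv.1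
  rw [hs.passesThreshold_iff hk] at h2
  have hk0 : (0 : ℝ) < k := by exact_mod_cast (by omega : 0 < k)
  have := lt_of_mul_lt_mul_left (h1.trans_lt h2) hk0.le
  linarith

/-- The potential does not decrease when an item is accepted. -/
theorem RankBound.potential_le_accept (hf : IsValuation f) (hs : s.Coherent f M R) (hk : 4 ≤ k)
    (hM : IsUniformMatroid M k) (h : RankBound f k s) {u : Ω} (hu : u ∉ R) {v : Option Ω}
    (hv : AcceptsUniform f k s u v) :
    uniformPotential f k s ≤ uniformPotential f k (s.accept u v) := by
  have hprop : (Rule.uniform k).Proposes f M s u v := hv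
  have hfit : (Rule.uniform k).Fits M := ⟨hk, hM⟩
  have hgain := hs.gain_le hf hu hprop.mem_held (hprop.indep hfit hs.indep)
  have hg0 := h.gain_nonneg hf hs hk hv
  obtain ⟨ha3, ha4, -⟩ := alphaUniform_spec k hk
  have hA := AgentState.Coherent.value_accepted_accept (f := f) s u v
  -- The potential rises by at least `α_k (w(u) - w_S(v)) - w(u)`.
  have hkey : s.newValue f u ≤ alphaUniform k * (s.newValue f u - s.removedValue f v) := by
    cases v with
    | none =>
      simp only [AgentState.removedValue, sub_zero] at hg0 ⊢
      nlinarith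
    | some v =>
      have h1 := h.minimal_le hk hv.2.1 hv.2.2.2
      have h2 := (hs.passesThreshold_iff hk).1 hv.1
      have hr := one_lt_uniformGrowth hk
      have hc := uniformGrowth_sub_one (k := k)
      simp only [AgentState.removedValue] at hg0 ⊢
      set x := s.newValue f u
      set y := s.currentValue f v
      set q := uniformGrowth k - 1
      have hq : 0 < q := by simp only [q]; linarith
      -- Rearranged, `y ≤ k q (x - y) ≤ (α_k - 1)(x - y)`; adding `x - y` gives the claim.
      have h3 : (1 + k * q) * y ≤ q * (k * x) :=
        h1.trans (mul_le_mul_of_nonneg_left h2.le hq.le)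
      have h4 : k * q ≤ alphaUniform k - 1 := by linarith
      have h5 := mul_le_mul_of_nonneg_right h4 hg0
      linarith
  have h6 := mul_le_mul_of_nonneg_left hgain (by linarith : 0 ≤ alphaUniform k)
  unfold uniformPotential
  rw [hA]
  linarith

/-- The new item takes rank 0 and the items ranked below the removed one move up. The old weighted
sum, multiplied by `r`, pays for the new weights of the kept items and for `α_k w_S(v)`. What
remains to be shown is `0 ≤ (r - 1)(k w(u) - Φ)`, which is the threshold condition. -/
theorem RankBound.accept (hf : IsValuation f) (hs : s.Coherent f M R) (hk : 4 ≤ k)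
    (hM : IsUniformMatroid M k) (h : RankBound f k s) {u : Ω} (hu : u ∉ R) {v : Option Ω}
    (hv : AcceptsUniform f k s u v) : RankBound f k (s.accept u v) := by
  have hprop : (Rule.uniform k).Proposes f M s u v := hv
  have hfit : (Rule.uniform k).Fits M := ⟨hk, hM⟩
  have hind := hprop.indep hfit hs.indep
  have huS : u ∉ s.S := fun h' => hu (hs.accepted_subset (hs.held_subset h'))
  have hpass : PassesThreshold f k s u := by
    cases v
    · exact hv.1
    · exact hv.1
  rw [hs.passesThreshold_iff hk] at hpass
  have hr := one_lt_uniformGrowth hk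
  have hpow := uniformGrowth_pow hk
  have hc := uniformGrowth_sub_one (k := k)
  have hcard : (s.accept u v).S.card ≤ k := by
    have := (hM _).1 hind
    rwa [Set.encard_coe_eq_coe_finsetCard, Nat.cast_le] at this
  obtain ⟨n, hn, hsum⟩ := h
  suffices H : ∃ n' : Ω → ℕ, (s.accept u v).S.image n' = Finset.range (s.accept u v).S.card ∧
      n' u = 0 ∧
      ∑ t ∈ v.elim s.S (fun x => s.S.erase x), uniformGrowth k ^ (n' t + 1) * s.currentValue f t
        + alphaUniform k * s.removedValue f v ≤
      uniformGrowth k * ∑ t ∈ s.S, uniformGrowth k ^ (n t + 1) * s.currentValue f t by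
    obtain ⟨n', hn', hn'u, hle⟩ := H
    refine ⟨n', hn', ?_⟩
    -- Current values may rise, which increases both sides of the invariant. The combined weights
    -- `α_k - r ^ (n' t + 1)` are non-negative because ranks are below `k` and `α_k = r ^ (k + 1)`.
    have hw := hs.weighted_sum_accept hf hu v
      (fun t => alphaUniform k - uniformGrowth k ^ (n' t + 1)) (fun t ht => by
        rw [← hpow, sub_nonneg]
        have := rank_lt_card hn' ht
        exact pow_le_pow_right₀ hr.le (by omega))
    simp only [sub_mul, Finset.sum_sub_distrib, ← Finset.mul_sum, hn'u, zero_add, pow_one] at hw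
    rw [(hs.accept hu hind).sum_currentValue] at hw
    have hA := AgentState.Coherent.value_accepted_accept (f := f) s u v
    have hW : ∑ t ∈ v.elim s.S (fun x => s.S.erase x), s.currentValue f t =
        f s.S - f ∅ - s.removedValue f v := by
      rw [← hs.sum_currentValue]
      cases v with
      | none => simp [AgentState.removedValue]
      | some x =>
        rw [← Finset.add_sum_erase _ _ (hprop.mem_held x rfl)]
        simp [AgentState.removedValue]
    rw [hW] at hw
    have h1 := mul_le_mul_of_nonneg_left hsum (by linarith : 0 ≤ uniformGrowth k)
    have h2 := mul_le_mul_of_nonneg_left hpass.le (by linarith : 0 ≤ uniformGrowth k - 1)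
    -- By the defining equation of `r`, `α_k - r = 1 + k (r - 1)`; the summand 1 pays for the growth
    -- of `w(A)`.
    have h3 : alphaUniform k * s.newValue f u - uniformGrowth k * s.newValue f u =
        s.newValue f u + (uniformGrowth k - 1) * (k * s.newValue f u) := by
      linear_combination (-s.newValue f u) * hc
    unfold uniformPotential at *
    rw [hA]
    linarith
  cases v with
  | none =>
    refine ⟨shiftedRank n s.S.card u, image_shiftedRank_insert hn huS, by simp [shiftedRank], ?_⟩
    simp only [Option.elim, AgentState.removedValue, mul_zero, add_zero, Finset.mul_sum]
    refine (Finset.sum_congr rfl fun t ht => ?_).le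
    have htu : t ≠ u := fun e => huS (e ▸ ht)
    have : shiftedRank n s.S.card u t = n t + 1 := by
      simp [shiftedRank, htu, rank_lt_card hn ht]
    rw [this]
    ring
  | some x =>
    refine ⟨shiftedRank n (n x) u, image_shiftedRank_exchange hn huS hv.2.2.1,
      by simp [shiftedRank], ?_⟩
    -- An exchange occurs only when `|S| = k`, so the factor `r ^ (|S| + 1)` is `α_k`.
    have := rank_sum_exchange_le hn huS hv.2.2.1 hv.2.2.2 hr.le
    rwa [hv.2.1, hpow] at this

end Uniform

/-! ### The rule for general matroids -/

section General

/-- Comparison of sums by comparison of all upper level sets. -/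
theorem sum_le_sum_of_card_superlevel_le {Ω : Type*} {g h : Ω → ℝ}
    (P Q : Finset Ω) (hh : ∀ t ∈ Q, 0 ≤ h t)
    (hcard : ∀ τ : ℝ, 0 ≤ τ → (P.filter (τ < g ·)).card ≤ (Q.filter (τ < h ·)).card) :
    ∑ u ∈ P, g u ≤ ∑ t ∈ Q, h t := by
  classical
  induction hm : P.card using Nat.strong_induction_on generalizing P Q with
  | _ m ih =>
    subst hm
    have hQ0 := Finset.sum_nonneg hh
    rcases P.eq_empty_or_nonempty with rfl | hne
    · simpa using hQ0
    obtain ⟨u, hu, humax⟩ := P.exists_max_image g hne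
    rcases le_or_gt (g u) 0 with hgu | hgu
    · exact (Finset.sum_nonpos fun x hx => (humax x hx).trans hgu).trans hQ0
    have hQ : Q.Nonempty := by
      have h0 := hcard 0 le_rfl
      have : 0 < (P.filter (0 < g ·)).card := Finset.card_pos.2 ⟨u, by simp [hu, hgu]⟩
      obtain ⟨x, hx⟩ := Finset.card_pos.1 (this.trans_le h0)
      exact ⟨x, (Finset.mem_filter.1 hx).1⟩
    obtain ⟨v, hv, hvmax⟩ := Q.exists_max_image h hQ
    have huv : g u ≤ h v := by
      by_contra! hlt
      have h0 := hcard (h v) (hh v hv)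
      have : 0 < (P.filter (h v < g ·)).card := Finset.card_pos.2 ⟨u, by simp [hu, hlt]⟩
      obtain ⟨x, hx⟩ := Finset.card_pos.1 (this.trans_le h0)
      obtain ⟨hx1, hx2⟩ := Finset.mem_filter.1 hx
      exact absurd (hvmax x hx1) (not_le.2 hx2)
    rw [← Finset.add_sum_erase _ _ hu, ← Finset.add_sum_erase _ _ hv]
    refine add_le_add huv (ih (P.erase u).card (Finset.card_erase_lt_of_mem hu) (P.erase u)
      (Q.erase v) (fun t ht => hh t (Finset.mem_of_mem_erase ht)) (fun τ hτ => ?_) rfl)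
    -- Below the maximum `g u ≤ h v`, both level sets lose exactly one element; from `g u` on, the
    -- one of `P` is empty.
    rcases le_or_gt (g u) τ with h1 | h1
    · have : (P.erase u).filter (τ < g ·) = ∅ := Finset.filter_eq_empty_iff.2 fun x hx =>
        not_lt.2 ((humax x (Finset.mem_of_mem_erase hx)).trans h1)
      simp [this]
    · have hP : u ∈ P.filter (τ < g ·) := Finset.mem_filter.2 ⟨hu, h1⟩
      have hQ' : v ∈ Q.filter (τ < h ·) := Finset.mem_filter.2 ⟨hv, h1.trans_le huv⟩
      rw [Finset.filter_erase, Finset.filter_erase, Finset.card_erase_of_mem hP,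
        Finset.card_erase_of_mem hQ']
      exact Nat.sub_le_sub_right (hcard τ hτ) 1

theorem mem_closure_of_mem_of_singleton_indep {Ω : Type*} {M : Matroid Ω}
    (hM : ∀ u, M.Indep {u}) {X : Set Ω} {x : Ω}
    (hx : x ∈ X) : x ∈ M.closure X :=
  M.mem_closure_of_mem' hx ((hM x).subset_ground rfl)

/-! ### Circuits, level sets and spans under exchanges. -/

variable {Ω : Type*} [DecidableEq Ω] {f : Finset Ω → ℝ} {M : Matroid Ω} {s : AgentState Ω}
  {R : Finset Ω} {p : Ω → ℝ}

/-- An item that cannot be added to the held set closes a circuit with the exchangeable items. -/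
theorem AgentState.exists_isCircuit_exchangeable (hM : ∀ u, M.Indep {u})
    (hS : M.Indep (s.S : Set Ω)) {u : Ω} (hu : u ∉ s.S)
    (hdep : ¬ M.Indep (insert u s.S : Finset Ω)) :
    ∃ C, M.IsCircuit C ∧ u ∈ C ∧ ∀ x, x ≠ u → (x ∈ C ↔ s.Exchangeable M u x) := by
  have hucl : u ∈ M.closure s.S := by
    rw [hS.mem_closure_iff']
    refine ⟨(hM u).subset_ground rfl, fun h => absurd ?_ hdep⟩
    rwa [Finset.coe_insert]
  have huS : u ∉ (s.S : Set Ω) := by simpa using hu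
  refine ⟨M.fundCircuit u s.S, hS.fundCircuit_isCircuit hucl huS, M.mem_fundCircuit u s.S,
    fun x hx => ?_⟩
  have hset : ((insert u (s.S.erase x) : Finset Ω) : Set Ω) = insert u (s.S : Set Ω) \ {x} := by
    rw [Finset.coe_insert, Finset.coe_erase, Set.insert_sdiff_singleton_comm hx.symm]
  rw [AgentState.Exchangeable, hset, ← hS.mem_fundCircuit_iff hucl huS]
  refine ⟨fun h => ⟨?_, h⟩, fun h => h.2⟩
  simpa [hx] using M.fundCircuit_subset_insert u s.S h

/-- The items held whose current value exceeds `τ`. -/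
def superlevel (f : Finset Ω → ℝ) (s : AgentState Ω) (τ : ℝ) : Set Ω :=
  {t | t ∈ s.S ∧ τ < s.currentValue f t}

/-- Each item that the agent did not get is spanned by the items held whose value is above any
level below half of the marginal value of the item, as far as this is not covered by `p`. -/
def SpansRejected (f : Finset Ω → ℝ) (M : Matroid Ω) (s : AgentState Ω) (R : Finset Ω)
    (p : Ω → ℝ) : Prop :=
  ∀ u ∈ R \ s.A, ∀ τ : ℝ, 0 ≤ τ → 2 * τ < marginal f s.A u - p u →
    u ∈ M.closure (superlevel f s τ)

theorem AcceptsGeneral.removedValue_le (hf : IsValuation f) {u : Ω} {v : Option Ω}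
    (hv : AcceptsGeneral f M s u v) : 2 * s.removedValue f v ≤ s.newValue f u := by
  cases v with
  | none =>
    simp only [AgentState.removedValue, mul_zero]
    exact hf.marginal_nonneg _ _
  | some v => exact hv.2.2.2

/-- A removed item `t` above level `τ` lies on a circuit with `u` and the exchangeable items. The
latter have at least its current value, and `w(u) ≥ 2 w_S(t)`, so the rest of the circuit survives
above `τ` and spans `t`. -/
theorem superlevel_subset_closure_accept (hf : IsValuation f) (hM : ∀ u, M.Indep {u})
    (hs : s.Coherent f M R) {u : Ω} (hu : u ∉ R) {v : Option Ω}
    (hv : AcceptsGeneral f M s u v) {τ : ℝ} (hτ : 0 ≤ τ) :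
    superlevel f s τ ⊆ M.closure (superlevel f (s.accept u v) τ) := by
  intro t ht
  have huS : u ∉ s.S := fun h' => hu (hs.accepted_subset (hs.held_subset h'))
  have hcur : ∀ x ∈ s.S, some x ≠ v → τ < s.currentValue f x →
      x ∈ superlevel f (s.accept u v) τ := by
    intro x hx hxv hlt
    refine ⟨Finset.mem_insert_of_mem ?_,
      hlt.trans_le (hs.currentValue_le_accept hf hu v (hs.held_subset hx))⟩
    cases v
    · exact hx
    · exact Finset.mem_erase.2 ⟨fun e => hxv (congrArg some e), hx⟩
  by_cases htv : some t = v
  · subst htv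
    obtain ⟨hnot, hex, hmin, hle⟩ := hv
    have hlt := ht.2
    have hpos : 0 < s.newValue f u := by linarith
    obtain ⟨C, hC, huC, hiff⟩ := s.exists_isCircuit_exchangeable hM hs.indep huS
      fun h => hnot ⟨h, hpos⟩
    have htu : t ≠ u := fun e => huS (e ▸ ht.1)
    refine M.closure_subset_closure ?_
      (hC.mem_closure_sdiff_singleton_of_mem ((hiff t htu).2 hex))
    rintro x ⟨hxC, hxt⟩
    by_cases hxu : x = u
    · rw [hxu]
      refine ⟨Finset.mem_insert_self _ _, lt_of_lt_of_le ?_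
        (AgentState.Coherent.newValue_le_accept hf s u _)⟩
      linarith
    · have hxex := (hiff x hxu).1 hxC
      exact hcur x hxex.1 (fun e => hxt (Option.some.inj e)) (hlt.trans_le (hmin x hxex))
  · exact mem_closure_of_mem_of_singleton_indep hM (hcur t ht.1 htv ht.2)

theorem SpansRejected.accept (hf : IsValuation f) (hM : ∀ u, M.Indep {u})
    (hs : s.Coherent f M R) (h : SpansRejected f M s R p) {u : Ω} (hu : u ∉ R) {v : Option Ω}
    (hv : AcceptsGeneral f M s u v) {p' : Ω → ℝ} (hp : ∀ x ∈ R, p' x = p x) :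
    SpansRejected f M (s.accept u v) (insert u R) p' := by
  intro x hx τ hτ hlt
  obtain ⟨hx1, hx2⟩ := Finset.mem_sdiff.1 hx
  have hxA : x ∉ insert u s.A := hx2
  rw [Finset.mem_insert, not_or] at hxA
  have hxR := (Finset.mem_insert.1 hx1).resolve_left hxA.1
  rw [hp x hxR] at hlt
  have hmar : marginal f (s.accept u v).A x ≤ marginal f s.A x :=
    hf.marginal_anti (Finset.subset_insert u s.A) x
  exact Matroid.closure_subset_closure_of_subset_closure
    (superlevel_subset_closure_accept hf hM hs hu hv hτ)
    (h x (Finset.mem_sdiff.2 ⟨hxR, hxA.2⟩) τ hτ (by linarith))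

/-- The circuit of the lost item spans it, so its least valuable held item `v` must exceed `τ`. If
the rule would accept, then `w(u) - p' u ≤ w_S(v)`; otherwise `w(u) < 2 w_S(v)`. Either way `2 τ <
w(u) - p' u` suffices. -/
theorem SpansRejected.insert (hM : ∀ u, M.Indep {u})
    (hs : s.Coherent f M R) (h : SpansRejected f M s R p) {u : Ω} (hu : u ∉ R)
    {p' : Ω → ℝ} (hp : ∀ x ∈ R, p' x = p x) (hp0 : 0 ≤ p' u)
    (hgain : ∀ v, AcceptsGeneral f M s u v → s.newValue f u - s.removedValue f v ≤ p' u) :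
    SpansRejected f M s (insert u R) p' := by
  intro x hx τ hτ hlt
  obtain ⟨hx1, hx2⟩ := Finset.mem_sdiff.1 hx
  rcases Finset.mem_insert.1 hx1 with rfl | hxR
  · have hxS : x ∉ s.S := fun h' => hu (hs.accepted_subset (hs.held_subset h'))
    have hnew : marginal f s.A x = s.newValue f x := rfl
    rw [hnew] at hlt
    have hpos : 0 < s.newValue f x := by linarith
    have hdep : ¬ M.Indep (Insert.insert x s.S : Finset Ω) := by
      intro hind
      -- Free acceptance would gain all of `w(x)`, so the credit would cover it completely.
      have := hgain none ⟨hind, hpos⟩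
      simp only [AgentState.removedValue] at this
      linarith
    obtain ⟨C, hC, hxC, hiff⟩ := s.exists_isCircuit_exchangeable hM hs.indep hxS hdep
    refine M.closure_subset_closure ?_ (hC.mem_closure_sdiff_singleton_of_mem hxC)
    rintro y ⟨hyC, hyx⟩
    have hyex := (hiff y hyx).1 hyC
    obtain ⟨v, hvex, hvmin⟩ := Set.exists_min_image {y | s.Exchangeable M x y}
      (s.currentValue f) (s.S.finite_toSet.subset fun y hy => hy.1) ⟨y, hyex⟩
    refine ⟨hyex.1, lt_of_lt_of_le ?_ (hvmin y hyex)⟩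
    by_cases hle : 2 * s.currentValue f v ≤ s.newValue f x
    · have := hgain (some v) ⟨fun h' => hdep h'.1, hvex, hvmin, hle⟩
      simp only [AgentState.removedValue] at this
      linarith
    · linarith
  · rw [hp x hxR] at hlt
    exact h x (Finset.mem_sdiff.2 ⟨hxR, hx2⟩) τ hτ hlt

/-- An independent set inside the span of a level set has at most as many elements as that level
set. These cardinality bounds at all levels compare the sums, with marginals halved. -/
theorem SpansRejected.sum_le (hf : IsValuation f) (hs : s.Coherent f M R)
    (h : SpansRejected f M s R p) {I : Finset Ω} (hI : M.Indep (I : Set Ω))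
    (hIR : I ⊆ R \ s.A) :
    ∑ u ∈ I, (marginal f s.A u - p u) ≤ 2 * (f s.S - f ∅) := by
  have key := sum_le_sum_of_card_superlevel_le (g := fun u => (marginal f s.A u - p u) / 2)
    (h := s.currentValue f) I s.S (fun t _ => hf.currentValue_nonneg s t) (fun τ hτ => ?_)
  · rw [hs.sum_currentValue, ← Finset.sum_div] at key
    linarith
  · have hsub : ((I.filter fun u => τ < (marginal f s.A u - p u) / 2 : Finset Ω) : Set Ω) ⊆
        M.closure (superlevel f s τ) := by
      intro u hu
      obtain ⟨hu1, hu2⟩ := Finset.mem_filter.1 (Finset.mem_coe.1 hu)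
      exact h u (hIR hu1) τ hτ (by linarith)
    have hle := (hI.subset (Finset.coe_subset.2 (Finset.filter_subset _ I))).encard_le_eRk_of_subset
      hsub
    rw [M.eRk_closure_eq] at hle
    have hle2 := hle.trans (M.eRk_le_encard _)
    have hQ : superlevel f s τ = ((s.S.filter (τ < s.currentValue f ·) : Finset Ω) : Set Ω) := by
      ext t
      simp [superlevel]
    rwa [hQ, Set.encard_coe_eq_coe_finsetCard, Set.encard_coe_eq_coe_finsetCard,
      Nat.cast_le] at hle2

end General

/-! ### Certificates of single agents -/

section Certificate

variable {Ω : Type*} [DecidableEq Ω] {f : Finset Ω → ℝ} {M : Matroid Ω} {s : AgentState Ω}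
  {R : Finset Ω} {p : Ω → ℝ} {r : Rule}

/-- What guarantees the competitive ratio of an agent when the items of `R` have arrived and the
loss of an item `u` to another agent may be charged to the credit `p u`. -/
def Rule.Certified (r : Rule) (f : Finset Ω → ℝ) (M : Matroid Ω) (s : AgentState Ω)
    (R : Finset Ω) (p : Ω → ℝ) : Prop :=
  match r with
  | .general => f s.A - f ∅ ≤ 2 * (f s.S - f ∅) ∧ SpansRejected f M s R p
  | .uniform k => RankBound f k s ∧
      ∀ u ∈ R \ s.A, k * (marginal f s.A u - p u) ≤ uniformPotential f k s

theorem AgentState.coherent_initial (f : Finset Ω → ℝ) (M : Matroid Ω) :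
    (AgentState.initial Ω).Coherent f M ∅ where
  held_subset := subset_rfl
  accepted_subset := subset_rfl
  prior_subset := fun _ _ => subset_rfl
  telescope := fun X hX => by simp [Finset.subset_empty.1 hX]
  indep := by simp [AgentState.initial]

theorem Rule.certified_initial (r : Rule) (f : Finset Ω → ℝ) (M : Matroid Ω) (p : Ω → ℝ) :
    r.Certified f M (AgentState.initial Ω) ∅ p := by
  cases r with
  | general => exact ⟨by simp [AgentState.initial], fun u hu => by simp at hu⟩
  | uniform k =>
    exact ⟨⟨fun _ => 0, by simp [AgentState.initial],
      by simp [AgentState.initial, uniformPotential]⟩, fun u hu => by simp at hu⟩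

/-- The gain of a proposed exchange is non-negative. -/
theorem Rule.Certified.gain_nonneg (hf : IsValuation f) (hr : r.Fits M) (hs : s.Coherent f M R)
    (h : r.Certified f M s R p) {u : Ω} {v : Option Ω} (hv : r.Proposes f M s u v) :
    0 ≤ s.newValue f u - s.removedValue f v := by
  cases r with
  | general =>
    have h1 := AcceptsGeneral.removedValue_le hf hv
    have h2 := hf.removedValue_nonneg s v
    linarith
  | uniform k => exact h.1.gain_nonneg hf hs hr.1 hv

theorem Rule.Certified.accept (hf : IsValuation f) (hM : ∀ u, M.Indep {u}) (hr : r.Fits M)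
    (hs : s.Coherent f M R) (h : r.Certified f M s R p) {u : Ω} (hu : u ∉ R) {v : Option Ω}
    (hv : r.Proposes f M s u v) {p' : Ω → ℝ} (hp : ∀ x ∈ R, p' x = p x) :
    r.Certified f M (s.accept u v) (insert u R) p' := by
  have hA := AgentState.Coherent.value_accepted_accept (f := f) s u v
  cases r with
  | general =>
    refine ⟨?_, h.2.accept hf hM hs hu hv hp⟩
    -- Since `w_S(v) ≤ w(u) / 2`, twice the gain covers the growth `w(u)` of `f(A)`.
    have h1 := AcceptsGeneral.removedValue_le hf hv
    have h2 := hs.gain_le hf hu hv.mem_held (hv.indep hr hs.indep)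
    have h3 := h.1
    linarith
  | uniform k =>
    refine ⟨h.1.accept hf hs hr.1 hr.2 hu hv, fun x hx => ?_⟩
    obtain ⟨hx1, hx2⟩ := Finset.mem_sdiff.1 hx
    have hxA : x ∉ insert u s.A := hx2
    rw [Finset.mem_insert, not_or] at hxA
    have hxR := (Finset.mem_insert.1 hx1).resolve_left hxA.1
    have hmar : marginal f (s.accept u v).A x ≤ marginal f s.A x :=
      hf.marginal_anti (Finset.subset_insert u s.A) x
    have h1 := h.2 x (Finset.mem_sdiff.2 ⟨hxR, hxA.2⟩)
    have h2 := h.1.potential_le_accept hf hs hr.1 hr.2 hu hv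
    rw [hp x hxR]
    refine le_trans (mul_le_mul_of_nonneg_left ?_ (Nat.cast_nonneg k)) (h1.trans h2)
    linarith

/-- For the uniform rule: below the threshold `k w(u) ≤ Φ` directly; above it, the credit covers
`w(u)` up to `w_S(v)`, and `k w_S(v) ≤ Φ`. -/
theorem Rule.Certified.insert (hf : IsValuation f) (hM : ∀ u, M.Indep {u}) (hr : r.Fits M)
    (hs : s.Coherent f M R) (h : r.Certified f M s R p) {u : Ω} (hu : u ∉ R)
    {p' : Ω → ℝ} (hp : ∀ x ∈ R, p' x = p x) (hp0 : 0 ≤ p' u)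
    (hgain : ∀ v, r.Proposes f M s u v → s.newValue f u - s.removedValue f v ≤ p' u) :
    r.Certified f M s (insert u R) p' := by
  cases r with
  | general => exact ⟨h.1, h.2.insert hM hs hu hp hp0 hgain⟩
  | uniform k =>
    refine ⟨h.1, fun x hx => ?_⟩
    obtain ⟨hx1, hx2⟩ := Finset.mem_sdiff.1 hx
    rcases Finset.mem_insert.1 hx1 with rfl | hxR
    · have hnew : marginal f s.A x = s.newValue f x := rfl
      have hk0 : (0 : ℝ) ≤ k := Nat.cast_nonneg k
      rw [hnew]
      by_cases hpass : PassesThreshold f k s x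
      · have hv : ∃ v, AcceptsUniform f k s x v := by
          by_cases hcard : s.S.card = k
          · have hne : s.S.Nonempty := Finset.card_pos.1 (by have := hr.1; omega)
            obtain ⟨v, hv, hvmin⟩ := s.S.exists_min_image (s.currentValue f) hne
            exact ⟨some v, hpass, hcard, hv, hvmin⟩
          · exact ⟨none, hpass, hcard⟩
        obtain ⟨v, hv⟩ := hv
        refine le_trans (mul_le_mul_of_nonneg_left ?_ hk0) (h.1.removedValue_le hf hr.1 hv)
        have := hgain v hv
        linarith
      · rw [hs.passesThreshold_iff hr.1, not_lt] at hpass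
        refine le_trans (mul_le_mul_of_nonneg_left ?_ hk0) hpass
        linarith
    · rw [hp x hxR]
      exact h.2 x (Finset.mem_sdiff.2 ⟨hxR, hx2⟩)

/-- A certified agent is competitive up to the credits of the items it did not get. -/
theorem Rule.Certified.value_le (hf : IsValuation f) (hr : r.Fits M) (hs : s.Coherent f M R)
    (h : r.Certified f M s R p) (hp : ∀ u, 0 ≤ p u) {α : ℝ} (hα : 0 < α) (hratio : 1 / α ≤ r.ratio)
    {I : Finset Ω} (hI : M.Indep (I : Set Ω)) (hIR : I ⊆ R) :
    f I ≤ α * f s.S + ∑ u ∈ I, p u := by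
  have h0 := hf.nonneg ∅
  have hS0 := hf.nonneg s.S
  have hI' : M.Indep ((I \ s.A : Finset Ω) : Set Ω) :=
    hI.subset (Finset.coe_subset.2 Finset.sdiff_subset)
  have hsub : I \ s.A ⊆ R \ s.A := Finset.sdiff_subset_sdiff hIR subset_rfl
  have h1 : f I ≤ f s.A + ∑ u ∈ I \ s.A, marginal f s.A u := by
    refine (hf.mono _ _ ?_).trans (hf.le_add_sum_marginal s.A (I \ s.A))
    rw [Finset.union_sdiff_self_eq_union]
    exact Finset.subset_union_right
  have h2 : ∑ u ∈ I \ s.A, p u ≤ ∑ u ∈ I, p u :=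
    Finset.sum_le_sum_of_subset_of_nonneg Finset.sdiff_subset fun u _ _ => hp u
  suffices H : f s.A + ∑ u ∈ I \ s.A, (marginal f s.A u - p u) ≤ α * f s.S by
    rw [Finset.sum_sub_distrib] at H
    linarith
  cases r with
  | general =>
    have hα4 : 4 ≤ α := le_of_one_div_le_one_div hα hratio
    have h3 := h.1
    have h4 := h.2.sum_le hf hs hI' hsub
    have h5 := mul_le_mul_of_nonneg_right hα4 hS0
    -- `f(A) ≤ 2 f(S) - f ∅` and the rest is at most `2 f(S) - 2 f ∅`, together at most `4 f(S)`.
    linarith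
  | uniform k =>
    obtain ⟨ha3, -, -⟩ := alphaUniform_spec k hr.1
    have hαk : alphaUniform k ≤ α := le_of_one_div_le_one_div hα hratio
    have hk0 : (0 : ℝ) < k := by
      have := hr.1
      exact_mod_cast (by omega : 0 < k)
    have hcard : ((I \ s.A).card : ℝ) ≤ k := by
      have := (hr.2 _).1 hI'
      rw [Set.encard_coe_eq_coe_finsetCard, Nat.cast_le] at this
      exact_mod_cast this
    have hΦ := h.1.potential_nonneg hf hr.1
    have h3 : k * ∑ u ∈ I \ s.A, (marginal f s.A u - p u) ≤ k * uniformPotential f k s := by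
      rw [Finset.mul_sum]
      refine (Finset.sum_le_sum fun u hu => h.2 u (hsub hu)).trans ?_
      rw [Finset.sum_const, nsmul_eq_mul]
      exact mul_le_mul_of_nonneg_right hcard hΦ
    have h4 := le_of_mul_le_mul_left h3 hk0
    have h5 := mul_le_mul_of_nonneg_right hαk hS0
    -- Adding `f(A)` to the potential leaves `α_k f(S) - (α_k - 1) f ∅`.
    have h6 := mul_nonneg (by linarith : 0 ≤ alphaUniform k - 1) h0
    unfold uniformPotential at h4
    linarith

end Certificate

/-! ### Analysis of the matching algorithm -/

section Analysis

variable {Ω Λ : Type*} [DecidableEq Ω] {f : Λ → Finset Ω → ℝ}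
  {M : Λ → Matroid Ω} {rule : Λ → Rule}

/-- Every arriving item can be processed. -/
theorem exists_matchingStep [DecidableEq Λ] [Finite Λ] (f : Λ → Finset Ω → ℝ) (M : Λ → Matroid Ω)
    (rule : Λ → Rule) (σ : Λ → AgentState Ω) (u : Ω) : ∃ τ, MatchingStep f M rule σ u τ := by
  by_cases h : ∀ l v, ¬ (rule l).Proposes (f l) (M l) (σ l) u v
  · exact ⟨σ, .discard h⟩
  · push Not at h
    obtain ⟨l₀, v₀, h₀⟩ := h
    -- There are finitely many proposals even if `Ω` is infinite: only held items or `none` can be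
    -- named.
    have hfin : {q : Σ _ : Λ, Option Ω |
        (rule q.1).Proposes (f q.1) (M q.1) (σ q.1) u q.2}.Finite := by
      have : (⋃ l : Λ, (Sigma.mk l) '' (insert none (some '' ((σ l).S : Set Ω)) :
          Set (Option Ω))).Finite :=
        Set.finite_iUnion fun l => (((σ l).S.finite_toSet.image _).insert _).image _
      refine this.subset ?_
      rintro ⟨l, v⟩ hq
      refine Set.mem_iUnion.2 ⟨l, v, ?_, rfl⟩
      cases v with
      | none => exact Or.inl rfl
      | some x => exact Or.inr ⟨x, Rule.Proposes.mem_held hq x rfl, rfl⟩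
    obtain ⟨⟨l, v⟩, hq, hmax⟩ := Set.exists_max_image _ (fun q : Σ _ : Λ, Option Ω =>
      (σ q.1).newValue (f q.1) u - (σ q.1).removedValue (f q.1) q.2) hfin ⟨⟨l₀, v₀⟩, h₀⟩
    exact ⟨_, .assign l v hq fun l' v' h' => hmax ⟨l', v'⟩ h'⟩

theorem exists_matchingRun [DecidableEq Λ] [Finite Λ] (f : Λ → Finset Ω → ℝ) (M : Λ → Matroid Ω)
    (rule : Λ → Rule) (σ : Λ → AgentState Ω) (items : List Ω) :
    ∃ τ, MatchingRun f M rule σ items τ := by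
  induction items generalizing σ with
  | nil => exact ⟨σ, .nil σ⟩
  | cons u us ih =>
    obtain ⟨σ', h⟩ := exists_matchingStep f M rule σ u
    obtain ⟨τ, hτ⟩ := ih σ'
    exact ⟨τ, .cons h hτ⟩

/-! ### Credits and the joint invariant of all agents. -/

variable [Fintype Λ]

/-- The invariant of the matching algorithm, where `R` is the set of the arrived items and `p u`
is the gain from the assignment of `u`. -/
structure MatchingInvariant (f : Λ → Finset Ω → ℝ) (M : Λ → Matroid Ω) (rule : Λ → Rule)
    (σ : Λ → AgentState Ω) (R : Finset Ω) (p : Ω → ℝ) : Prop where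
  credit_nonneg : ∀ u, 0 ≤ p u
  credit_le : ∑ u ∈ R, p u ≤ ∑ l, (f l (σ l).S - f l ∅)
  coherent : ∀ l, (σ l).Coherent (f l) (M l) R
  certified : ∀ l, (rule l).Certified (f l) (M l) (σ l) R p
  disjoint : ∀ l l', l ≠ l' → Disjoint (σ l).A (σ l').A

theorem matchingInvariant_initial (f : Λ → Finset Ω → ℝ) (M : Λ → Matroid Ω)
    (rule : Λ → Rule) :
    MatchingInvariant f M rule (fun _ => AgentState.initial Ω) ∅ (fun _ => 0) where
  credit_nonneg := fun _ => le_rfl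
  credit_le := by simp [AgentState.initial]
  coherent := fun l => AgentState.coherent_initial (f l) (M l)
  certified := fun l => (rule l).certified_initial (f l) (M l) _
  disjoint := fun _ _ _ => Finset.disjoint_empty_left _

/-- The credit function is changed only at the fresh item, so the certificates for older items
persist. The winner's certificate absorbs an acceptance, and every other agent's absorbs a loss
covered by the credit. -/
theorem MatchingInvariant.step [DecidableEq Λ] (hf : ∀ l, IsValuation (f l))
    (hM : ∀ l u, (M l).Indep {u})
    (hrule : ∀ l, (rule l).Fits (M l)) {σ τ : Λ → AgentState Ω} {R : Finset Ω} {p : Ω → ℝ}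
    (h : MatchingInvariant f M rule σ R p) {u : Ω} (hu : u ∉ R)
    (hstep : MatchingStep f M rule σ u τ) :
    ∃ p', MatchingInvariant f M rule τ (insert u R) p' := by
  have hagree : ∀ g : ℝ, ∀ x ∈ R, Function.update p u g x = p x := fun g x hx =>
    Function.update_of_ne (ne_of_mem_of_not_mem hx hu) _ _
  have hnonneg : ∀ g : ℝ, 0 ≤ g → ∀ x, 0 ≤ Function.update p u g x := by
    intro g hg x
    by_cases hx : x = u
    · simpa [hx] using hg
    · simpa [hx] using h.credit_nonneg x
  have hsum : ∀ g : ℝ, ∑ x ∈ insert u R, Function.update p u g x = g + ∑ x ∈ R, p x := by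
    intro g
    rw [Finset.sum_insert hu, Function.update_self, Finset.sum_congr rfl (hagree g)]
  cases hstep with
  | discard hno =>
    refine ⟨Function.update p u 0, hnonneg 0 le_rfl, ?_,
      fun l => (h.coherent l).mono (Finset.subset_insert u R), fun l => ?_, h.disjoint⟩
    · rw [hsum, zero_add]
      exact h.credit_le
    · exact (h.certified l).insert (hf l) (hM l) (hrule l) (h.coherent l) hu (hagree 0)
        (hnonneg 0 le_rfl u) fun v hv => absurd hv (hno l v)
  | assign l v hv hmax =>
    set g := (σ l).newValue (f l) u - (σ l).removedValue (f l) v with hg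
    have hg0 : 0 ≤ g := (h.certified l).gain_nonneg (hf l) (hrule l) (h.coherent l) hv
    have hind := hv.indep (hrule l) (h.coherent l).indep
    have huA : ∀ l', u ∉ (σ l').A := fun l' h' => hu ((h.coherent l').accepted_subset h')
    refine ⟨Function.update p u g, hnonneg g hg0, ?_, fun l' => ?_, fun l' => ?_,
      fun l₁ l₂ hne => ?_⟩
    · have hgain := (h.coherent l).gain_le (hf l) hu hv.mem_held hind
      have hc := h.credit_le
      have hrest : ∑ l' ∈ Finset.univ.erase l,
          (f l' (Function.update σ l ((σ l).accept u v) l').S - f l' ∅) =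
          ∑ l' ∈ Finset.univ.erase l, (f l' (σ l').S - f l' ∅) :=
        Finset.sum_congr rfl fun l' hl' => by
          rw [Function.update_of_ne (Finset.ne_of_mem_erase hl')]
      rw [← Finset.add_sum_erase _ _ (Finset.mem_univ l)] at hc
      rw [hsum, ← Finset.add_sum_erase _ _ (Finset.mem_univ l), hrest, Function.update_self]
      linarith
    · by_cases hl : l' = l
      · subst hl
        rw [Function.update_self]
        exact (h.coherent l').accept hu hind
      · rw [Function.update_of_ne hl]
        exact (h.coherent l').mono (Finset.subset_insert u R)
    · by_cases hl : l' = l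
      · subst hl
        rw [Function.update_self]
        exact (h.certified l').accept (hf l') (hM l') (hrule l') (h.coherent l') hu hv (hagree g)
      · rw [Function.update_of_ne hl]
        refine (h.certified l').insert (hf l') (hM l') (hrule l') (h.coherent l') hu (hagree g)
          (hnonneg g hg0 u) fun v' hv' => ?_
        -- The greedy choice is used here: the winning gain dominates the proposal of every loser.
        rw [Function.update_self]
        exact hmax l' v' hv'
    · have hacc : ((σ l).accept u v).A = insert u (σ l).A := rfl
      by_cases h1 : l₁ = l
      · subst h1
        rw [Function.update_self, Function.update_of_ne hne.symm, hacc,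
          Finset.disjoint_insert_left]
        exact ⟨huA l₂, h.disjoint _ _ hne⟩
      · rw [Function.update_of_ne h1]
        by_cases h2 : l₂ = l
        · subst h2
          rw [Function.update_self, hacc, Finset.disjoint_insert_right]
          exact ⟨huA l₁, h.disjoint _ _ hne⟩
        · rw [Function.update_of_ne h2]
          exact h.disjoint _ _ hne

theorem MatchingInvariant.run [DecidableEq Λ] (hf : ∀ l, IsValuation (f l))
    (hM : ∀ l u, (M l).Indep {u})
    (hrule : ∀ l, (rule l).Fits (M l)) {σ τ : Λ → AgentState Ω} {items : List Ω}
    (hrun : MatchingRun f M rule σ items τ) {R : Finset Ω} {p : Ω → ℝ}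
    (h : MatchingInvariant f M rule σ R p) (hnodup : items.Nodup)
    (hnew : ∀ u ∈ items, u ∉ R) :
    ∃ p', MatchingInvariant f M rule τ (R ∪ items.toFinset) p' := by
  induction hrun generalizing R p with
  | nil σ => exact ⟨p, by simpa using h⟩
  | @cons σ σ' τ u us hstep hrun ih =>
    obtain ⟨p', h'⟩ := h.step hf hM hrule (hnew u List.mem_cons_self) hstep
    obtain ⟨hu, hus⟩ := List.nodup_cons.1 hnodup
    have hnew' : ∀ x ∈ us, x ∉ insert u R := by
      intro x hx hx'
      rcases Finset.mem_insert.1 hx' with rfl | hxR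
      · exact hu hx
      · exact hnew x (List.mem_cons_of_mem _ hx) hxR
    have := ih h' hus hnew'
    rwa [Finset.insert_union, ← Finset.union_insert, ← List.toFinset_cons] at this

theorem MatchingInvariant.total_value_le (hf : ∀ l, IsValuation (f l))
    (hrule : ∀ l, (rule l).Fits (M l)) {α : ℝ} (hα : 0 < α)
    (hratio : ∀ l, 1 / α ≤ (rule l).ratio) {σ : Λ → AgentState Ω} {items : List Ω} {p : Ω → ℝ}
    (h : MatchingInvariant f M rule σ items.toFinset p) {OPT : Λ → Finset Ω}
    (hOPT : IsAssignment M items OPT) :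
    ∑ l, f l (OPT l) ≤ (α + 1) * ∑ l, f l (σ l).S := by
  have h1 : ∑ l, f l (OPT l) ≤ ∑ l, (α * f l (σ l).S + ∑ u ∈ OPT l, p u) :=
    Finset.sum_le_sum fun l _ => (h.certified l).value_le (hf l) (hrule l) (h.coherent l)
      h.credit_nonneg hα (hratio l) (hOPT.indep l) (hOPT.arrived l)
  have h2 : ∑ l, ∑ u ∈ OPT l, p u ≤ ∑ u ∈ items.toFinset, p u := by
    rw [← Finset.sum_biUnion fun l _ l' _ hne => hOPT.disjoint l l' hne]
    exact Finset.sum_le_sum_of_subset_of_nonneg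
      (Finset.biUnion_subset.2 fun l _ => hOPT.arrived l) fun u _ _ => h.credit_nonneg u
  have h3 : ∑ l, (f l (σ l).S - f l ∅) ≤ ∑ l, f l (σ l).S :=
    Finset.sum_le_sum fun l _ => by linarith [(hf l).nonneg ∅]
  have h4 := h.credit_le
  rw [Finset.sum_add_distrib, ← Finset.mul_sum] at h1
  linarith

end Analysis

theorem mainTheorem7 {Ω Λ : Type*} [DecidableEq Ω] [Fintype Λ] [DecidableEq Λ]
    (f : Λ → Finset Ω → ℝ) (hf : ∀ l, IsValuation (f l))
    (M : Λ → Matroid Ω) (hM : ∀ l u, (M l).Indep {u})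
    (rule : Λ → Rule) (hrule : ∀ l, (rule l).Fits (M l))
    (α : ℝ) (hα : 0 < α) (hratio : ∀ l, 1 / α ≤ (rule l).ratio) :
    IsCompetitive f M (MatchingOutcome f M rule) (1 / (α + 1)) := by
  intro items hnodup
  constructor
  · obtain ⟨τ, hτ⟩ := exists_matchingRun f M rule (fun _ => AgentState.initial Ω) items
    exact ⟨fun l => (τ l).S, τ, hτ, fun _ => rfl⟩
  · rintro X ⟨τ, hrun, hX⟩
    obtain rfl : X = fun l => (τ l).S := funext hX
    obtain ⟨p, h⟩ := MatchingInvariant.run hf hM hrule hrun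
      (matchingInvariant_initial f M rule) hnodup (by simp)
    rw [Finset.empty_union] at h
    refine ⟨⟨fun l => (h.coherent l).held_subset.trans (h.coherent l).accepted_subset,
      fun l l' hne => (h.disjoint l l' hne).mono (h.coherent l).held_subset
        (h.coherent l').held_subset, fun l => (h.coherent l).indep⟩, fun OPT hOPT => ?_⟩
    rw [one_div, inv_mul_le_iff₀ (by linarith)]
    exact h.total_value_le hf hrule hα hratio hOPT
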